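/- Let $k$ be an algebraically closed field of characteristic zero. For integers $d\ge 1$, $\delta\ge 0$ and $\mu_1,\dots,\mu_r\ge 0$, let $l(d,\delta,\mu_1,\dots,\mu_r)$ be the dimension of the $k$-vector space of homogeneous polynomials of degree $\delta$ in $k[X_0,\dots,X_d]$ (together with $0$) that vanish to order at least $\mu_j$ at $p_j$ for $j=1,\dots,r$, where $p_1,\dots,p_r\in\mathbb P^d$ are general points, i.e. the common value of this dimension for all $(p_1,\dots,p_r)$ in some nonempty Zariski open subset of $(\mathbb P^d)^r$ (which may depend on $\delta$ and the $\mu_j$); write $l(d,\delta,\mu^r)$ when $\mu_1=\dots=\mu_r=\mu$. Let $d\ge 2$ and let $r=s^d$ for some integer $s\ge 2$, with $(r,d)\notin\{(4,2),(9,2),(8,3)\}$. Then for all integers $\mu\ge 1$ and $\delta\ge 0$ with $\delta\le s\mu$, $$l(d,\delta,\mu^r)=0,$$ that is, for $r$ general points of $\mathbb P^d$ no nonzero form of degree $\delta$ vanishes to order at least $\mu$ at each of them. -/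

import Mathlib

open scoped LinearAlgebra.Projectivization

namespace FatPoints

/-- Projective `d`-space over `k`, as the set of its `k`-points. -/
abbrev ProjSpace (k : Type*) [Field k] (d : ℕ) : Type _ :=
  ℙ k (Fin (d + 1) → k)

/-- A polynomial in the variables `X (j, i)`, with `j` the index of a factor of `(ℙ^d)^r` and `i` the
index of a homogeneous coordinate on it, is multihomogeneous if, for some multidegree `D`, it is
homogeneous of degree `D j` in the variables `X (j, 0), …, X (j, d)` for each `j`. -/
def IsMultihomogeneous {k : Type*} [Field k] {d r : ℕ}
    (f : MvPolynomial (Fin r × Fin (d + 1)) k) : Prop :=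
  ∃ D : Fin r → ℕ,
    MvPolynomial.IsWeightedHomogeneous (fun x : Fin r × Fin (d + 1) => (Pi.single x.1 1 : Fin r → ℕ))
      f D

/-- Zariski closed subsets of `(ℙ^d)^r`: the common zero loci of sets of multihomogeneous
polynomials. For such polynomials, vanishing does not depend on the chosen representatives. -/
def IsZariskiClosed {k : Type*} [Field k] {d r : ℕ} (V : Set (Fin r → ProjSpace k d)) : Prop :=
  ∃ S : Set (MvPolynomial (Fin r × Fin (d + 1)) k),
    (∀ f ∈ S, IsMultihomogeneous f) ∧
    ∀ p : Fin r → ProjSpace k d,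
      p ∈ V ↔ ∀ f ∈ S, MvPolynomial.eval (fun x => (p x.1).rep x.2) f = 0

/-- Zariski open subsets of `(ℙ^d)^r`. -/
def IsZariskiOpen {k : Type*} [Field k] {d r : ℕ} (U : Set (Fin r → ProjSpace k d)) : Prop :=
  IsZariskiClosed Uᶜ

/-- The homogeneous ideal of a point of `ℙ^d`, generated by the forms that vanish at it. -/
noncomputable def pointIdeal {k : Type*} [Field k] {d : ℕ} (p : ProjSpace k d) :
    Ideal (MvPolynomial (Fin (d + 1)) k) :=
  Ideal.span {f | (∃ n : ℕ, f.IsHomogeneous n) ∧ MvPolynomial.eval p.rep f = 0}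

/-- The space of forms of degree `δ` (together with `0`) that vanish at `p j` to order at least
`m j` for every `j`. A form vanishes at a point to order at least `m` if and only if it lies in the
`m`-th power of the homogeneous ideal of the point (that ideal is generated by `d` of the
coordinates in a suitable linear coordinate system, so its powers are saturated). -/
noncomputable def fatForms {k : Type*} [Field k] {d r : ℕ} (δ : ℕ) (p : Fin r → ProjSpace k d)
    (m : Fin r → ℕ) : Submodule k (MvPolynomial (Fin (d + 1)) k) :=
  MvPolynomial.homogeneousSubmodule (Fin (d + 1)) k δ ⊓
    ⨅ j, (pointIdeal (p j) ^ m j).restrictScalars k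

/-- `l(d, δ, m₁, …, m_r) = n`: for general points `p₁, …, p_r` of `ℙ^d`, that is, for all `p` in
some nonempty Zariski open subset of `(ℙ^d)^r`, the forms of degree `δ` that vanish at `p j` to
order at least `m j` for every `j` make up a vector space of dimension `n`. -/
def GeneralDimEq (k : Type*) [Field k] (d δ : ℕ) {r : ℕ} (m : Fin r → ℕ) (n : ℕ) : Prop :=
  ∃ U : Set (Fin r → ProjSpace k d), IsZariskiOpen U ∧ U.Nonempty ∧
    ∀ p ∈ U, Module.rank k (fatForms δ p m) = n

end FatPoints

/-! It is enough to find one r-tuple of points at which the linear system of vanishing conditions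
has trivial kernel: a maximal minor nonzero there stays nonzero on a Zariski open set. The tuple is
taken on a curve that starts at the grid `{0, …, s-1}^d` in affine space.

Let `P = gridPoly`, the monic polynomial with simple roots `0, …, s-1`. A polynomial of degree at
most `sμ` that vanishes to order `μ` on the grid is a combination `f = ∑ λ_b ∏ P(x_i)^{b_i}` over
`|b| = μ` (`coord_eq_zero_of_taylorCoeff` and a degree count). So the grid itself does not suffice,
and each point `c` is moved to `c + t a(c)`. If `f + t g` still vanishes to order `μ` modulo `t²`,
then for `|b| = μ - 1` the digit `G_b` of `g` (its coefficient at `∏ P(x_i)^{b_i}`, reduced to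
degree `< s` in each variable) satisfies `G_b(c) + ∑_j (b_j + 1) λ_{b+e_j} P'(c_j) a_j(c) = 0` on
the grid. The choice `a_j(c) = c^{(s-1,…,s-1)-e_j} / P'(c_j)` turns this into an identity of reduced
polynomials. The corner monomials have such high degree that `G_b` cannot contain them when `s + 2 ≤
d(s-1)`, so every `λ` is zero (`eq_zero_of_vanish_first_order`).

Hence a kernel vector over `k[t]` is divisible by `t`, so by all powers of `t`, and is zero
(`eq_zero_of_mulVec_eq_zero`). Some maximal minor is then a nonzero polynomial in `t`, and a
suitable value of `t` gives the tuple. -/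

namespace FatPoints

/-! ### Expansion of univariate polynomials in powers of the grid polynomial -/

section Univariate

open Polynomial

/-- The monic polynomial with simple roots `0, 1, …, s - 1`. -/
noncomputable def gridPoly (k : Type*) [Field k] (s : ℕ) : k[X] :=
  Lagrange.nodal (Finset.range s) (fun n : ℕ => (n : k))

/-- The `gridPoly`-adic basis of `k[X]`, with one monic polynomial in each degree. -/
noncomputable def gridBasis (k : Type*) [Field k] (s n : ℕ) : k[X] :=
  gridPoly k s ^ (n / s) * X ^ (n % s)

variable {k : Type*} [Field k] {s : ℕ}

lemma monic_gridBasis (n : ℕ) : (gridBasis k s n).Monic :=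
  ((Lagrange.nodal_monic).pow _).mul (monic_X_pow _)

lemma natDegree_gridBasis (n : ℕ) : (gridBasis k s n).natDegree = n := by
  have h : (gridPoly k s).Monic := Lagrange.nodal_monic
  rw [gridBasis, (h.pow _).natDegree_mul (monic_X_pow _), h.natDegree_pow, natDegree_X_pow,
    gridPoly, Lagrange.natDegree_nodal, Finset.card_range, mul_comm, Nat.div_add_mod]

lemma exists_eq_sum_gridBasis (n : ℕ) : ∀ p : k[X], p.degree < n →
    ∃ a : ℕ → k, p = ∑ m ∈ Finset.range n, C (a m) * gridBasis k s m := by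
  induction n with
  | zero =>
    intro p hp
    exact ⟨0, by simpa using hp⟩
  | succ n ih =>
    intro p hp
    have hc : (gridBasis k s n).coeff n = 1 := by
      have := monic_gridBasis (k := k) (s := s) n
      rwa [Monic, leadingCoeff, natDegree_gridBasis] at this
    obtain ⟨a, ha⟩ := ih (p - C (p.coeff n) * gridBasis k s n) (by
      rw [degree_lt_iff_coeff_zero] at hp ⊢
      intro m hm
      rcases hm.eq_or_lt with rfl | hm
      · simp [hc]
      · rw [coeff_sub, hp m hm, coeff_C_mul,
          coeff_eq_zero_of_natDegree_lt ((natDegree_gridBasis n).trans_lt hm)]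
        simp)
    refine ⟨Function.update a n (p.coeff n), ?_⟩
    rw [Finset.sum_range_succ, Function.update_self, ← sub_eq_iff_eq_add, ha]
    refine Finset.sum_congr rfl fun m hm => ?_
    rw [Function.update_of_ne (Finset.mem_range.1 hm).ne]

/-- After translation by a root `c`, `gridPoly` is `X * u` with `u(0) = P'(c)`, so the basis element
has no terms below order `n / s`, and its coefficient there is read off at `0`. -/
lemma coeff_taylor_gridBasis {c : k} (hc : (gridPoly k s).eval c = 0) (n b : ℕ) (h : b ≤ n / s) :
    (taylor c (gridBasis k s n)).coeff b =
      if n / s = b then (derivative (gridPoly k s)).eval c ^ b * c ^ (n % s) else 0 := by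
  have hP : taylor c (gridPoly k s) = (taylor c (gridPoly k s)).divX * X := by
    have := divX_mul_X_add (taylor c (gridPoly k s))
    rw [taylor_coeff_zero, hc] at this
    simpa using this.symm
  have hu : (taylor c (gridPoly k s)).divX.coeff 0 = (derivative (gridPoly k s)).eval c := by
    rw [coeff_divX, taylor_coeff_one]
  rw [gridBasis, taylor_mul, taylor_pow, taylor_pow, hP, mul_pow, mul_right_comm,
    coeff_mul_X_pow', taylor_X]
  rcases h.eq_or_lt with h | h
  · subst h
    simp [coeff_zero_eq_eval_zero, ← hu]
  · rw [if_neg h.not_ge, if_neg h.ne']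

lemma eval_gridPoly {n : ℕ} (hn : n < s) : (gridPoly k s).eval (n : k) = 0 :=
  Lagrange.eval_nodal_at_node (v := fun n : ℕ => (n : k)) (Finset.mem_range.2 hn)

lemma eval_derivative_gridPoly [CharZero k] {n : ℕ} (hn : n < s) :
    (derivative (gridPoly k s)).eval (n : k) ≠ 0 := by
  have := Lagrange.eval_nodal_derivative_eval_node_eq (v := fun n : ℕ => (n : k))
    (Finset.mem_range.2 hn)
  rw [gridPoly, this, Lagrange.eval_nodal]
  refine Finset.prod_ne_zero_iff.2 fun m hm => sub_ne_zero.2 ?_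
  exact_mod_cast (Finset.ne_of_mem_erase hm).symm

end Univariate

/-! ### Expansion in several variables and vanishing on the grid -/

section Multivariate

open MvPolynomial

variable {k : Type*} [Field k] {d s : ℕ}

/-- The coefficient of `x ^ b` in the Taylor expansion of a polynomial at `c`. -/
noncomputable def taylorCoeff {ι : Type*} (c : ι → k) (b : ι →₀ ℕ) : MvPolynomial ι k →ₗ[k] k :=
  lcoeff k b ∘ₗ (aeval fun i => X i + C (c i) : MvPolynomial ι k →ₐ[k] MvPolynomial ι k).toLinearMap

/-- Products of the univariate polynomials `gridBasis` in the separate variables. -/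
noncomputable def mvGridBasis (k : Type*) [Field k] {d : ℕ} (s : ℕ) (α : Fin d →₀ ℕ) :
    MvPolynomial (Fin d) k :=
  ∏ i, Polynomial.aeval (X i) (gridBasis k s (α i))

lemma coeff_prod_aeval_X {ι : Type*} [Fintype ι] (q : ι → Polynomial k) (b : ι →₀ ℕ) :
    coeff b (∏ i, Polynomial.aeval (X i : MvPolynomial ι k) (q i)) = ∏ i, (q i).coeff (b i) := by
  classical
  have h : ∀ i, Polynomial.aeval (X i : MvPolynomial ι k) (q i) =
      ∑ n ∈ Finset.range (max (b i) (q i).natDegree + 1), C ((q i).coeff n) * X i ^ n := by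
    intro i
    rw [Polynomial.aeval_eq_sum_range' (n := max (b i) (q i).natDegree + 1)
      (Nat.lt_succ_of_le (le_max_right _ _))]
    simp [smul_eq_C_mul]
  simp_rw [h]
  rw [Finset.prod_univ_sum, coeff_sum]
  have h2 : ∀ x : ι → ℕ, ∏ i, (C ((q i).coeff (x i)) * X i ^ x i : MvPolynomial ι k) =
      monomial (Finsupp.equivFunOnFinite.symm x) (∏ i, (q i).coeff (x i)) := by
    intro x
    rw [Finset.prod_mul_distrib, monomial_eq, map_prod, Finsupp.prod_fintype _ _ (by simp)]
    rfl
  simp_rw [h2, coeff_monomial]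
  rw [Finset.sum_eq_single (b : ι → ℕ)]
  · simp
  · intro x _ hx
    rw [if_neg]
    rintro rfl
    exact hx rfl
  · intro hb
    exact (hb (by simp [Fintype.mem_piFinset])).elim

lemma taylorCoeff_prod_aeval_X {ι : Type*} [Fintype ι] (c : ι → k) (b : ι →₀ ℕ)
    (p : ι → Polynomial k) :
    taylorCoeff c b (∏ i, Polynomial.aeval (X i : MvPolynomial ι k) (p i)) =
      ∏ i, (Polynomial.taylor (c i) (p i)).coeff (b i) := by
  rw [← coeff_prod_aeval_X]
  simp only [taylorCoeff, LinearMap.comp_apply, AlgHom.toLinearMap_apply, lcoeff_apply, map_prod]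
  congr 1
  refine Finset.prod_congr rfl fun i _ => ?_
  rw [← Polynomial.aeval_algHom_apply, aeval_X, Polynomial.taylor_apply, Polynomial.aeval_comp]
  simp [algebraMap_eq]

lemma monomial_eq_smul_prod_aeval_X {ι : Type*} [Fintype ι] (β : ι →₀ ℕ) (a : k) :
    (monomial β a : MvPolynomial ι k) =
      a • ∏ i, Polynomial.aeval (X i : MvPolynomial ι k) (Polynomial.X ^ β i : Polynomial k) := by
  rw [monomial_eq, smul_eq_C_mul, Finsupp.prod_fintype _ _ (by simp)]
  simp

lemma taylorCoeff_monomial {ι : Type*} [Fintype ι] (c : ι → k) (b β : ι →₀ ℕ) (a : k) :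
    taylorCoeff c b (monomial β a) =
      a * ∏ i, (((β i).choose (b i) : ℕ) : k) * c i ^ (β i - b i) := by
  rw [monomial_eq_smul_prod_aeval_X, map_smul, taylorCoeff_prod_aeval_X, smul_eq_mul]
  congr 1
  refine Finset.prod_congr rfl fun i _ => ?_
  simp [Polynomial.coeff_X_add_C_pow, mul_comm]

/-- The univariate change of basis is triangular in the degree, so expanding each variable of a
monomial separately never raises an exponent. -/
lemma mem_span_mvGridBasis {D : ℕ} {f : MvPolynomial (Fin d) k} (hf : f.totalDegree ≤ D) :
    f ∈ Submodule.span k (mvGridBasis k s '' {α | α.degree ≤ D}) := by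
  classical
  rw [f.as_sum]
  refine Submodule.sum_mem _ fun α hα => ?_
  have hα' : α.degree ≤ D := (le_totalDegree hα).trans hf
  have h : ∀ n : ℕ, ∃ a : ℕ → k, (Polynomial.X ^ n : Polynomial k) =
      ∑ m ∈ Finset.range (n + 1), Polynomial.C (a m) * gridBasis k s m := fun n =>
    exists_eq_sum_gridBasis (n + 1) _ (by
      rw [Polynomial.degree_X_pow]; exact_mod_cast Nat.lt_succ_self n)
  choose a ha using h
  rw [monomial_eq_smul_prod_aeval_X]
  refine Submodule.smul_mem _ _ ?_
  simp_rw [ha, map_sum]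
  rw [Finset.prod_univ_sum]
  refine Submodule.sum_mem _ fun x hx => ?_
  have hx' : ∏ i, Polynomial.aeval (X i : MvPolynomial (Fin d) k)
      (Polynomial.C (a (α i) (x i)) * gridBasis k s (x i)) =
      (∏ i, a (α i) (x i)) • mvGridBasis k s (Finsupp.equivFunOnFinite.symm x) := by
    simp [mvGridBasis, Finset.prod_mul_distrib, smul_eq_C_mul, map_prod, algebraMap_eq]
  rw [hx']
  refine Submodule.smul_mem _ _ (Submodule.subset_span ⟨_, ?_, rfl⟩)
  refine le_trans ?_ hα'
  rw [Finsupp.degree_eq_sum, Finsupp.degree_eq_sum]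
  refine Finset.sum_le_sum fun i _ => ?_
  have := Fintype.mem_piFinset.1 hx i
  simpa [Nat.lt_succ_iff] using this

/-- Componentwise quotient of an exponent by `s`. -/
noncomputable def quo (s : ℕ) (α : Fin d →₀ ℕ) : Fin d →₀ ℕ := α.mapRange (· / s) (Nat.zero_div s)

/-- Componentwise remainder of an exponent modulo `s`. -/
noncomputable def rem (s : ℕ) (α : Fin d →₀ ℕ) : Fin d →₀ ℕ := α.mapRange (· % s) (Nat.zero_mod s)

@[simp] lemma quo_apply (α : Fin d →₀ ℕ) (i : Fin d) : quo s α i = α i / s := rfl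

@[simp] lemma rem_apply (α : Fin d →₀ ℕ) (i : Fin d) : rem s α i = α i % s := rfl

lemma smul_quo_add_rem (α : Fin d →₀ ℕ) : s • quo s α + rem s α = α := by
  ext i
  simp [Nat.div_add_mod]

lemma quo_smul_add {b γ : Fin d →₀ ℕ} (hγ : ∀ i, γ i < s) : quo s (s • b + γ) = b := by
  ext i
  have : 0 < s := (Nat.zero_le _).trans_lt (hγ i)
  simp [Nat.mul_add_div this, Nat.div_eq_of_lt (hγ i)]

lemma rem_smul_add {b γ : Fin d →₀ ℕ} (hγ : ∀ i, γ i < s) : rem s (s • b + γ) = γ := by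
  ext i
  simp [Nat.mod_eq_of_lt (hγ i)]

lemma degree_eq_smul_quo_add (α : Fin d →₀ ℕ) :
    α.degree = s * (quo s α).degree + (rem s α).degree := by
  conv_lhs => rw [← smul_quo_add_rem (s := s) α]
  rw [map_add, map_nsmul, smul_eq_mul]

/-- The reduced polynomial which is the coefficient of `∏ i, gridPoly k s (X i) ^ b i` in the
expansion with coordinates `l` in the basis `mvGridBasis`. -/
noncomputable def gridDigit (s : ℕ) (b : Fin d →₀ ℕ) (l : (Fin d →₀ ℕ) →₀ k) :
    MvPolynomial (Fin d) k :=
  ∑ α ∈ l.support with quo s α = b, monomial (rem s α) (l α)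

lemma coeff_gridDigit {b γ : Fin d →₀ ℕ} (hγ : ∀ i, γ i < s) (l : (Fin d →₀ ℕ) →₀ k) :
    coeff γ (gridDigit s b l) = l (s • b + γ) := by
  classical
  rw [gridDigit, coeff_sum]
  simp_rw [coeff_monomial]
  rw [← Finset.sum_filter, Finset.filter_filter]
  rw [Finset.sum_eq_single (s • b + γ)]
  · intro α hα hne
    obtain ⟨-, rfl, rfl⟩ := Finset.mem_filter.1 hα
    exact (hne (smul_quo_add_rem α).symm).elim
  · intro h
    by_contra hne
    exact h (Finset.mem_filter.2
      ⟨Finsupp.mem_support_iff.2 hne, quo_smul_add hγ, rem_smul_add hγ⟩)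

lemma degreeOf_gridDigit (hs : 0 < s) (b : Fin d →₀ ℕ) (l : (Fin d →₀ ℕ) →₀ k) (i : Fin d) :
    degreeOf i (gridDigit s b l) < s := by
  rw [gridDigit]
  refine (degreeOf_sum_le _ _ _).trans_lt ((Finset.sup_lt_iff hs).2 fun α hα => ?_)
  refine (degreeOf_le_iff.2 fun m hm => ?_).trans_lt (Nat.mod_lt (α i) hs)
  have := support_monomial_subset hm
  rw [Finset.mem_singleton.1 this, rem_apply]

/-- If `quo s α ≠ b`, the inequality of degrees forces `b i < α i / s` for some `i`, and the factor
in that variable vanishes at `c i` to order greater than `b i`. -/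
lemma taylorCoeff_mvGridBasis {c : Fin d → k} (hc : ∀ i, (gridPoly k s).eval (c i) = 0)
    {b α : Fin d →₀ ℕ} (h : b.degree ≤ (quo s α).degree) :
    taylorCoeff c b (mvGridBasis k s α) = if quo s α = b then
      (∏ i, (Polynomial.derivative (gridPoly k s)).eval (c i) ^ b i) *
        ∏ i, c i ^ rem s α i else 0 := by
  rw [mvGridBasis, taylorCoeff_prod_aeval_X]
  split_ifs with hb
  · rw [← Finset.prod_mul_distrib]
    refine Finset.prod_congr rfl fun i _ => ?_
    have hi : α i / s = b i := by rw [← hb, quo_apply]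
    rw [coeff_taylor_gridBasis (hc i) _ _ hi.ge, if_pos hi, rem_apply]
  · obtain ⟨i, hi⟩ : ∃ i, b i < α i / s := by
      by_contra! hle
      refine hb (Finsupp.ext fun i => ?_)
      rw [Finsupp.degree_eq_sum, Finsupp.degree_eq_sum] at h
      have h' := (Finset.sum_eq_sum_iff_of_le fun i _ => hle i).1
        (le_antisymm (Finset.sum_le_sum fun i _ => hle i) h)
      exact h' i (Finset.mem_univ i)
    refine Finset.prod_eq_zero (Finset.mem_univ i) ?_
    rw [coeff_taylor_gridBasis (hc i) _ _ hi.le, if_neg hi.ne']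

lemma taylorCoeff_linearCombination {c : Fin d → k} (hc : ∀ i, (gridPoly k s).eval (c i) = 0)
    {b : Fin d →₀ ℕ} {l : (Fin d →₀ ℕ) →₀ k}
    (hl : ∀ α, (quo s α).degree < b.degree → l α = 0) :
    taylorCoeff c b (Finsupp.linearCombination k (mvGridBasis k s) l) =
      (∏ i, (Polynomial.derivative (gridPoly k s)).eval (c i) ^ b i) *
        eval c (gridDigit s b l) := by
  classical
  rw [Finsupp.linearCombination_apply, Finsupp.sum, map_sum, gridDigit, map_sum, Finset.mul_sum,
    Finset.sum_filter]
  refine Finset.sum_congr rfl fun α hα => ?_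
  rw [map_smul, taylorCoeff_mvGridBasis hc
    (not_lt.1 fun h => Finsupp.mem_support_iff.1 hα (hl α h)), smul_eq_mul, mul_ite, mul_zero]
  split_ifs with hb
  · rw [eval_monomial, Finsupp.prod_fintype _ _ (by simp)]
    ring
  · rfl

variable [CharZero k]

/-- A reduced polynomial that vanishes on the grid `{0, …, s - 1} ^ d` is zero. -/
lemma eq_zero_of_eval_grid {f : MvPolynomial (Fin d) k} (hf : ∀ i, degreeOf i f < s)
    (h : ∀ c : Fin d → Fin s, eval (fun i => ((c i : ℕ) : k)) f = 0) : f = 0 := by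
  classical
  refine eq_zero_of_eval_zero_at_prod_finset f
    (fun _ => (Finset.range s).image fun n : ℕ => (n : k)) (fun i => ?_) fun x hx => ?_
  · rw [Finset.card_image_of_injective _ Nat.cast_injective, Finset.card_range]
    exact hf i
  · have hx' : ∀ i, ∃ n : Fin s, ((n : ℕ) : k) = x i := fun i => by
      obtain ⟨n, hn, h⟩ := Finset.mem_image.1 (hx i)
      exact ⟨⟨n, Finset.mem_range.1 hn⟩, h⟩
    choose c hc using hx'
    rw [← h c]
    congr
    exact (funext hc).symm

/-- A polynomial that vanishes to order `m` on the grid has no coordinates below order `m`. -/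
lemma coord_eq_zero_of_taylorCoeff {m : ℕ} (hs : 0 < s) {l : (Fin d →₀ ℕ) →₀ k}
    (h : ∀ (c : Fin d → Fin s) (b : Fin d →₀ ℕ), b.degree < m →
      taylorCoeff (fun i => ((c i : ℕ) : k)) b
        (Finsupp.linearCombination k (mvGridBasis k s) l) = 0)
    (α : Fin d →₀ ℕ) (hα : (quo s α).degree < m) : l α = 0 := by
  induction hn : (quo s α).degree using Nat.strong_induction_on generalizing α with
  | _ n ih =>
    -- With all lower coordinates zero, the Taylor coefficient of exponent `quo s α` at a grid point
    -- is the value of this digit times a product of powers of `P'`, nonzero because the roots are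
    -- simple.
    have hd : gridDigit s (quo s α) l = 0 := by
      refine eq_zero_of_eval_grid (degreeOf_gridDigit hs _ _) fun c => ?_
      have := h c (quo s α) hα
      rw [taylorCoeff_linearCombination (fun i => eval_gridPoly (c i).2)
        fun β hβ => ih _ (hn ▸ hβ) β (hβ.trans hα) rfl] at this
      exact (mul_eq_zero.1 this).resolve_left (Finset.prod_ne_zero_iff.2 fun i _ =>
        pow_ne_zero _ (eval_derivative_gridPoly (c i).2))
    have := coeff_gridDigit (s := s) (b := quo s α) (γ := rem s α) (fun i => Nat.mod_lt _ hs) l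
    rw [hd, smul_quo_add_rem, coeff_zero] at this
    exact this.symm

end Multivariate

/-! ### First-order deformation of the grid -/

section Deformation

open MvPolynomial

variable {k : Type*} [Field k] {d s : ℕ}

/-- The exponent `(s - 1, …, s - 1) - e_j`. -/
noncomputable def cornerExp (s : ℕ) (j : Fin d) : Fin d →₀ ℕ :=
  Finsupp.equivFunOnFinite.symm fun i => if i = j then s - 2 else s - 1

lemma cornerExp_apply (i j : Fin d) : cornerExp s j i = if i = j then s - 2 else s - 1 := rfl

lemma cornerExp_lt (hs : 2 ≤ s) (i j : Fin d) : cornerExp s j i < s := by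
  rw [cornerExp_apply]
  split_ifs <;> omega

lemma cornerExp_injective (hs : 2 ≤ s) : Function.Injective (cornerExp (d := d) s) := by
  intro i j h
  by_contra hne
  have := DFunLike.congr_fun h i
  rw [cornerExp_apply, cornerExp_apply, if_pos rfl, if_neg hne] at this
  omega

lemma degree_cornerExp (hs : 2 ≤ s) (j : Fin d) : (cornerExp s j).degree + 1 = d * (s - 1) := by
  have h : cornerExp s j + Finsupp.single j 1 =
      Finsupp.equivFunOnFinite.symm fun _ : Fin d => s - 1 := by
    ext i
    rw [Finsupp.add_apply, cornerExp_apply, Finsupp.single_apply]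
    simp only [eq_comm (a := j), Finsupp.equivFunOnFinite_symm_apply_apply]
    split_ifs <;> omega
  have h' := congrArg Finsupp.degree h
  rw [map_add, Finsupp.degree_single] at h'
  rw [h', Finsupp.degree_eq_sum]
  simp

/-- The direction in which the point `c` of the grid is moved. -/
noncomputable def gridDir (k : Type*) [Field k] (c : Fin d → Fin s) (j : Fin d) : k :=
  (∏ i, ((c i : ℕ) : k) ^ cornerExp s j i) /
    (Polynomial.derivative (gridPoly k s)).eval ((c j : ℕ) : k)

/-- If all coordinates have degree at most `s * μ`, then the digits of order `μ` are constants. -/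
lemma eval_gridDigit_of_degree_le (hs : 0 < s) {μ : ℕ} {l : (Fin d →₀ ℕ) →₀ k}
    (hl : ∀ α, s * μ < α.degree → l α = 0) {b : Fin d →₀ ℕ} (hb : b.degree = μ) (c : Fin d → k) :
    eval c (gridDigit s b l) = l (s • b) := by
  have h0 : ∀ i, (0 : Fin d →₀ ℕ) i < s := fun _ => hs
  have hq : quo s (s • b) = b := by simpa using quo_smul_add (b := b) h0
  have hr : rem s (s • b) = 0 := by simpa using rem_smul_add (b := b) h0
  rw [gridDigit, map_sum, Finset.sum_eq_single (s • b)]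
  · simp [hr]
  · intro α hα hne
    obtain ⟨hα, hαb⟩ := Finset.mem_filter.1 hα
    have h := le_of_not_gt fun h => Finsupp.mem_support_iff.1 hα (hl α h)
    rw [degree_eq_smul_quo_add (s := s), hαb, hb] at h
    have h0 : rem s α = 0 := (Finsupp.degree_eq_zero_iff _).1 (by omega)
    rw [← smul_quo_add_rem (s := s) α, hαb, h0, add_zero] at hne
    exact (hne rfl).elim
  · intro h
    have : l (s • b) = 0 := by
      by_contra hne
      exact h (Finset.mem_filter.2 ⟨Finsupp.mem_support_iff.2 hne, hq⟩)
    rw [this, monomial_zero, map_zero]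

lemma exists_coord {D : ℕ} {f : MvPolynomial (Fin d) k} (hf : f.totalDegree ≤ D) :
    ∃ l : (Fin d →₀ ℕ) →₀ k, (∀ α, D < α.degree → l α = 0) ∧
      Finsupp.linearCombination k (mvGridBasis k s) l = f := by
  obtain ⟨l, hl, h⟩ := (Finsupp.mem_span_image_iff_linearCombination k).1
    (mem_span_mvGridBasis (s := s) hf)
  refine ⟨l, fun α hα => ?_, h⟩
  by_contra hne
  exact absurd (hl (Finsupp.mem_support_iff.2 hne)) (not_le.2 hα)

/-- To first order, no polynomial of degree at most `s * μ` keeps vanishing to order `μ` at the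
points of the grid when these are moved in the directions `gridDir`. -/
theorem eq_zero_of_vanish_first_order [CharZero k] {μ : ℕ} (hs : 2 ≤ s)
    (hds : s + 2 ≤ d * (s - 1)) (hμ : 1 ≤ μ) {f g : MvPolynomial (Fin d) k}
    (hf : f.totalDegree ≤ s * μ) (hg : g.totalDegree ≤ s * μ)
    (hvf : ∀ (c : Fin d → Fin s) (b : Fin d →₀ ℕ), b.degree < μ →
      taylorCoeff (fun i => ((c i : ℕ) : k)) b f = 0)
    (hvg : ∀ (c : Fin d → Fin s) (b : Fin d →₀ ℕ), b.degree < μ →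
      taylorCoeff (fun i => ((c i : ℕ) : k)) b g + ∑ j, gridDir k c j * (b j + 1 : ℕ) *
        taylorCoeff (fun i => ((c i : ℕ) : k)) (b + Finsupp.single j 1) f = 0) : f = 0 := by
  classical
  have hs0 : 0 < s := by omega
  obtain ⟨l, hl, rfl⟩ := exists_coord (s := s) hf
  obtain ⟨n, hn, rfl⟩ := exists_coord (s := s) hg
  have hlμ := coord_eq_zero_of_taylorCoeff hs0 hvf
  have key : ∀ (b : Fin d →₀ ℕ) (j : Fin d), b.degree + 1 = μ →
      l (s • (b + Finsupp.single j 1)) = 0 := by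
    intro b j hb
    have hbj : ∀ j, (b + Finsupp.single j 1).degree = μ := fun j => by
      rw [map_add, Finsupp.degree_single, hb]
    -- Below order `μ - 1` the correction terms are Taylor coefficients of `f` of order less than
    -- `μ`, hence zero; so `g` itself vanishes to order `μ - 1` on the grid.
    have hnb : ∀ α, (quo s α).degree < b.degree → n α = 0 := by
      refine coord_eq_zero_of_taylorCoeff hs0 fun c b' hb' => ?_
      have h := hvg c b' (by omega)
      rwa [Finset.sum_eq_zero, add_zero] at h
      intro i _
      rw [hvf, mul_zero]
      rw [map_add, Finsupp.degree_single]
      omega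
    have hG : gridDigit s b n + ∑ i, monomial (cornerExp s i)
        ((b i + 1 : ℕ) * l (s • (b + Finsupp.single i 1))) = 0 := by
      refine eq_zero_of_eval_grid (s := s) (fun i => ?_) fun c => ?_
      · refine (degreeOf_add_le _ _ _).trans_lt (max_lt (degreeOf_gridDigit hs0 _ _ _) ?_)
        refine (degreeOf_sum_le _ _ _).trans_lt ((Finset.sup_lt_iff hs0).2 fun m _ => ?_)
        refine (degreeOf_le_iff.2 fun α hα => ?_).trans_lt (cornerExp_lt hs i m)
        rw [Finset.mem_singleton.1 (support_monomial_subset hα)]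
      · have hc : ∀ i, (gridPoly k s).eval ((c i : ℕ) : k) = 0 := fun i => eval_gridPoly (c i).2
        have hu : ∀ i, (Polynomial.derivative (gridPoly k s)).eval ((c i : ℕ) : k) ≠ 0 :=
          fun i => eval_derivative_gridPoly (c i).2
        have h := hvg c b (by omega)
        rw [taylorCoeff_linearCombination hc hnb] at h
        -- Raising the order by `e_i` produces one extra factor `P'(c i)`, which the denominator of
        -- `gridDir` cancels; what remains is the value of a corner monomial.
        have hsum : ∀ i, gridDir k c i * (b i + 1 : ℕ) *
            taylorCoeff (fun i => ((c i : ℕ) : k)) (b + Finsupp.single i 1)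
              (Finsupp.linearCombination k (mvGridBasis k s) l) =
            (∏ i, (Polynomial.derivative (gridPoly k s)).eval ((c i : ℕ) : k) ^ b i) *
              eval (fun i => ((c i : ℕ) : k)) (monomial (cornerExp s i)
                ((b i + 1 : ℕ) * l (s • (b + Finsupp.single i 1)))) := fun i => by
          rw [taylorCoeff_linearCombination hc (fun α hα => hlμ α (hbj i ▸ hα)),
            eval_gridDigit_of_degree_le hs0 hl (hbj i), eval_monomial,
            Finsupp.prod_fintype _ _ (by simp), gridDir]
          have hp : ∏ m, (Polynomial.derivative (gridPoly k s)).eval ((c m : ℕ) : k) ^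
              (b + Finsupp.single i 1 : Fin d →₀ ℕ) m =
              (∏ m, (Polynomial.derivative (gridPoly k s)).eval ((c m : ℕ) : k) ^ b m) *
                (Polynomial.derivative (gridPoly k s)).eval ((c i : ℕ) : k) := by
            simp_rw [Finsupp.add_apply, pow_add]
            rw [Finset.prod_mul_distrib]
            congr 1
            rw [Finset.prod_eq_single i (fun m _ hm => by
              rw [Finsupp.single_eq_of_ne hm, pow_zero]) (by simp)]
            simp
          rw [hp]
          field_simp [hu i]
        rw [Finset.sum_congr rfl fun i _ => hsum i, ← Finset.mul_sum, ← mul_add] at h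
        rw [map_add, map_sum]
        exact (mul_eq_zero.1 h).resolve_left
          (Finset.prod_ne_zero_iff.2 fun i _ => pow_ne_zero _ (hu i))
    have h := congrArg (coeff (cornerExp s j)) hG
    rw [coeff_add, coeff_gridDigit (cornerExp_lt hs · j), hn, zero_add, coeff_sum,
      Finset.sum_eq_single j, coeff_monomial, if_pos rfl, coeff_zero, mul_eq_zero] at h
    · exact h.resolve_left (Nat.cast_ne_zero.2 (Nat.succ_ne_zero _))
    · intro i _ hi
      rw [coeff_monomial, if_neg fun h => hi (cornerExp_injective hs h)]
    · simp
    -- The exponent `s • b + cornerExp s j` has degree `s(μ-1) + d(s-1) - 1`, which exceeds `sμ`,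
    -- the degree bound on `g`, exactly when `s + 2 ≤ d(s-1)`.
    · have := degree_cornerExp hs j
      rw [map_add, map_nsmul, smul_eq_mul, ← hb]
      nlinarith
  -- Order at least `μ` and degree at most `sμ` leave only exponents `s • b'` with `|b'| = μ`; as `μ
  -- ≥ 1`, such a `b'` is some `b + e_j`, which `key` covers.
  have hl0 : l = 0 := by
    ext α
    by_contra hne
    rw [Finsupp.zero_apply] at hne
    have h1 := le_of_not_gt fun h => hne (hl α h)
    have h2 := le_of_not_gt fun h => hne (hlμ α h)
    rw [degree_eq_smul_quo_add (s := s)] at h1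
    have h3 : (quo s α).degree = μ :=
      le_antisymm (Nat.le_of_mul_le_mul_left (by omega) hs0) h2
    rw [h3] at h1
    have h4 : rem s α = 0 := (Finsupp.degree_eq_zero_iff _).1 (by omega)
    obtain ⟨j, hj⟩ : ∃ j, quo s α j ≠ 0 := by
      by_contra! h
      have : quo s α = 0 := Finsupp.ext h
      rw [this, map_zero] at h3
      omega
    have h5 : quo s α - Finsupp.single j 1 + Finsupp.single j 1 = quo s α :=
      tsub_add_cancel_of_le (Finsupp.single_le_iff.2 (Nat.one_le_iff_ne_zero.2 hj))
    refine hne ?_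
    rw [← smul_quo_add_rem (s := s) α, h4, add_zero, ← h5]
    refine key _ j ?_
    have h6 := congrArg Finsupp.degree h5
    rw [map_add, Finsupp.degree_single, h3] at h6
    exact h6
  rw [hl0, map_zero]

end Deformation

/-! ### Trivial kernel over a domain gives a nonzero maximal minor -/

section Minors

open scoped Matrix

/-- The rows span over the fraction field: otherwise a nonzero functional kills them all, and
clearing its denominators gives a nonzero kernel vector over `R`. A basis chosen among the rows then
gives the minor. -/
lemma exists_det_submatrix_ne_zero {R m n : Type*} [CommRing R] [IsDomain R] [Fintype n]
    [DecidableEq n] (M : Matrix m n R) (h : ∀ w : n → R, M *ᵥ w = 0 → w = 0) :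
    ∃ ρ : n → m, (M.submatrix ρ id).det ≠ 0 := by
  let K := FractionRing R
  let v : m → n → K := fun i j => algebraMap R K (M i j)
  have hspan : Submodule.span K (Set.range v) = ⊤ := by
    by_contra hne
    obtain ⟨φ, hφ, hker⟩ := Submodule.exists_le_ker_of_lt_top _ (lt_top_iff_ne_top.2 hne)
    let y : n → K := fun j => φ (Pi.single j 1)
    have hy : ∀ x : n → K, φ x = ∑ j, x j * y j := fun x => by
      conv_lhs => rw [← Finset.univ_sum_single x]
      rw [map_sum]
      refine Finset.sum_congr rfl fun j _ => ?_
      rw [← smul_eq_mul, ← map_smul, ← Pi.single_smul, smul_eq_mul, mul_one]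
    obtain ⟨a, ha⟩ := IsLocalization.exist_integer_multiples_of_finite (nonZeroDivisors R) y
    choose w hw using ha
    have ha0 : algebraMap R K a ≠ 0 := IsFractionRing.to_map_ne_zero_of_mem_nonZeroDivisors a.2
    have hw0 : w = 0 := h w <| by
      ext i
      apply IsFractionRing.injective R K
      have hi : φ (v i) = 0 := hker (Submodule.subset_span ⟨i, rfl⟩)
      simp only [Matrix.mulVec, dotProduct, map_sum, map_mul, hw, Algebra.smul_def, Pi.zero_apply,
        map_zero]
      rw [hy] at hi
      rw [← mul_zero (algebraMap R K a), ← hi, Finset.mul_sum]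
      exact Finset.sum_congr rfl fun j _ => mul_left_comm _ _ _
    refine hφ (LinearMap.ext fun x => ?_)
    rw [hy, LinearMap.zero_apply]
    refine Finset.sum_eq_zero fun j _ => ?_
    have := hw j
    rw [hw0, Pi.zero_apply, map_zero, Algebra.smul_def, eq_comm, mul_eq_zero] at this
    rw [this.resolve_left ha0, mul_zero]
  obtain ⟨κ, a, -, hκ, hli⟩ := exists_linearIndependent' K v
  let B := Module.Basis.mk hli (hκ.trans hspan).ge
  let e : n ≃ κ := (Pi.basisFun K n).indexEquiv B
  refine ⟨a ∘ e, fun hdet => ?_⟩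
  have hrow : LinearIndependent K ((M.submatrix (a ∘ e) id).map (algebraMap R K)).row :=
    hli.comp e e.injective
  have hunit := (Matrix.isUnit_iff_isUnit_det _).1 (Matrix.linearIndependent_rows_iff_isUnit.1 hrow)
  rw [← RingHom.mapMatrix_apply, ← RingHom.map_det, hdet, map_zero] at hunit
  exact not_isUnit_zero hunit

end Minors

/-! ### Vanishing conditions as a matrix, and openness of a nonzero minor -/

section ConditionMatrix

open MvPolynomial

/-- The exponents of the monomials of degree `δ` in `d + 1` variables. -/
abbrev FormExp (d δ : ℕ) : Type :=
  ↥(Finset.finsuppAntidiag (Finset.univ : Finset (Fin (d + 1))) δ)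

/-- A point together with a derivative of order less than `μ`. -/
abbrev Condition (r d μ : ℕ) : Type := Fin r × {a : Fin (d + 1) →₀ ℕ // a.degree < μ}

/-- The matrix of the linear conditions on the coefficients of a form of degree `δ` to vanish to
order `μ` at the points `X (j, ·)`. -/
noncomputable def conditionMatrix (k : Type*) [Field k] (d r δ μ : ℕ) :
    Matrix (Condition r d μ) (FormExp d δ) (MvPolynomial (Fin r × Fin (d + 1)) k) := fun ρ β =>
  ∏ i, C (((β.1 i).choose (ρ.2.1 i) : ℕ) : k) * X (ρ.1, i) ^ (β.1 i - ρ.2.1 i)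

variable {k : Type*} [Field k] {d r δ μ : ℕ}

lemma degree_formExp (β : FormExp d δ) : β.1.degree = δ := by
  rw [Finsupp.degree_eq_sum]
  exact (Finset.mem_finsuppAntidiag.1 β.2).1

/-- Truncated subtraction does no harm: wherever it truncates, the binomial coefficient is zero and
so is the entry. -/
lemma conditionMatrix_eq_zero_or (ρ : Condition r d μ) (β : FormExp d δ) :
    conditionMatrix k d r δ μ ρ β = 0 ∨
      ∑ i, (β.1 i - ρ.2.1 i) = δ - ρ.2.1.degree := by
  by_cases h : ρ.2.1 ≤ β.1
  · right
    have h' : β.1 - ρ.2.1 + ρ.2.1 = β.1 := tsub_add_cancel_of_le h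
    have := congrArg Finsupp.degree h'
    rw [map_add, degree_formExp] at this
    rw [Finsupp.degree_eq_sum] at this
    exact Nat.eq_sub_of_add_eq this
  · left
    obtain ⟨i, hi⟩ : ∃ i, β.1 i < ρ.2.1 i := by
      by_contra! hle
      exact h hle
    exact Finset.prod_eq_zero (Finset.mem_univ i) (by rw [Nat.choose_eq_zero_of_lt hi]; simp)

lemma isWeightedHomogeneous_conditionMatrix (ρ : Condition r d μ) (β : FormExp d δ) :
    IsWeightedHomogeneous (fun x : Fin r × Fin (d + 1) => (Pi.single x.1 1 : Fin r → ℕ))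
      (conditionMatrix k d r δ μ ρ β) (Pi.single ρ.1 (δ - ρ.2.1.degree)) := by
  rcases conditionMatrix_eq_zero_or (k := k) ρ β with h | h
  · rw [h]
    exact isWeightedHomogeneous_zero _ _ _
  · rw [← h]
    have hd : (Pi.single ρ.1 (∑ i, (β.1 i - ρ.2.1 i)) : Fin r → ℕ) =
        ∑ i, (0 + (β.1 i - ρ.2.1 i) • Pi.single ρ.1 1) := by
      simp_rw [zero_add, ← Finset.sum_smul, ← Pi.single_smul, smul_eq_mul, mul_one]
    rw [hd]
    exact IsWeightedHomogeneous.prod _ _ _ fun i _ =>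
      (isWeightedHomogeneous_C _ _).mul ((isWeightedHomogeneous_X _ _ _).pow _)

/-- The multidegree of an entry depends only on its row, so all terms of the determinant have the
same multidegree. -/
lemma isMultihomogeneous_det (ρ : FormExp d δ → Condition r d μ) :
    IsMultihomogeneous ((conditionMatrix k d r δ μ).submatrix ρ id).det := by
  refine ⟨∑ β, Pi.single (ρ β).1 (δ - (ρ β).2.1.degree), ?_⟩
  rw [Matrix.det_apply]
  refine (weightedHomogeneousSubmodule k _ _).sum_mem fun σ _ => ?_
  rw [Units.smul_def]
  refine zsmul_mem ?_ _
  rw [mem_weightedHomogeneousSubmodule, ← Equiv.sum_comp σ]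
  exact IsWeightedHomogeneous.prod _ _ _ fun β _ => isWeightedHomogeneous_conditionMatrix _ _

lemma eval_conditionMatrix (v : Fin r × Fin (d + 1) → k) (ρ : Condition r d μ)
    (β : FormExp d δ) :
    eval v (conditionMatrix k d r δ μ ρ β) =
      ∏ i, (((β.1 i).choose (ρ.2.1 i) : ℕ) : k) * v (ρ.1, i) ^ (β.1 i - ρ.2.1 i) := by
  simp [conditionMatrix, map_prod]

lemma eval_conditionMatrix_smul (u : Fin r → k) (v : Fin r × Fin (d + 1) → k)
    (ρ : Condition r d μ) (β : FormExp d δ) :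
    eval (fun x => u x.1 * v x) (conditionMatrix k d r δ μ ρ β) =
      u ρ.1 ^ (δ - ρ.2.1.degree) * eval v (conditionMatrix k d r δ μ ρ β) := by
  rcases conditionMatrix_eq_zero_or (k := k) ρ β with h | h
  · rw [h, map_zero, map_zero, mul_zero]
  · rw [eval_conditionMatrix, eval_conditionMatrix, ← h, ← Finset.prod_pow_eq_pow_sum,
      ← Finset.prod_mul_distrib]
    refine Finset.prod_congr rfl fun i _ => ?_
    rw [mul_pow]
    ring

lemma eval_det_smul (ρ : FormExp d δ → Condition r d μ) (u : Fin r → k)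
    (v : Fin r × Fin (d + 1) → k) :
    eval (fun x => u x.1 * v x) ((conditionMatrix k d r δ μ).submatrix ρ id).det =
      (∏ β, u (ρ β).1 ^ (δ - (ρ β).2.1.degree)) *
        eval v ((conditionMatrix k d r δ μ).submatrix ρ id).det := by
  rw [RingHom.map_det, RingHom.map_det, ← Matrix.det_mul_column]
  congr 1
  ext β γ
  exact eval_conditionMatrix_smul _ _ _ _

/-- A polynomial in the `m`-th power of the ideal of a point has no Taylor coefficients of degree
less than `m` there. -/
lemma taylorCoeff_eq_zero_of_mem_pow {p : ProjSpace k d} {m : ℕ}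
    {F : MvPolynomial (Fin (d + 1)) k} (hF : F ∈ pointIdeal p ^ m) {a : Fin (d + 1) →₀ ℕ}
    (ha : a.degree < m) : taylorCoeff p.rep a F = 0 := by
  let τ : MvPolynomial (Fin (d + 1)) k →ₐ[k] MvPolynomial (Fin (d + 1)) k :=
    aeval fun i => X i + C (p.rep i)
  have h1 : (pointIdeal p).map τ ≤ idealOfVars (Fin (d + 1)) k := by
    rw [pointIdeal, Ideal.map_span, Ideal.span_le]
    rintro _ ⟨f, ⟨-, hf⟩, rfl⟩
    have hc : constantCoeff (τ f) = 0 := by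
      have : constantCoeff.comp (τ : MvPolynomial (Fin (d + 1)) k →+* MvPolynomial (Fin (d + 1)) k) =
          eval p.rep := by
        ext <;> simp [τ]
      rw [← hf, ← this]
      rfl
    rw [SetLike.mem_coe, ← pow_one (idealOfVars _ _), mem_pow_idealOfVars_iff]
    intro x hx
    by_contra hlt
    have hx0 : x = 0 := (Finsupp.degree_eq_zero_iff _).1 (by omega)
    rw [hx0, mem_support_iff] at hx
    exact hx hc
  have h2 : τ F ∈ idealOfVars (Fin (d + 1)) k ^ m :=
    Ideal.pow_right_mono h1 m (Ideal.map_pow τ (pointIdeal p) m ▸ Ideal.mem_map_of_mem τ hF)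
  rw [mem_pow_idealOfVars_iff] at h2
  by_contra hne
  exact absurd (h2 a (mem_support_iff.2 hne)) (not_le.2 ha)

lemma sum_conditionMatrix_mul_coeff {F : MvPolynomial (Fin (d + 1)) k} (hF : F.IsHomogeneous δ)
    (v : Fin r × Fin (d + 1) → k) (ρ : Condition r d μ) :
    ∑ β : FormExp d δ, eval v (conditionMatrix k d r δ μ ρ β) * coeff β.1 F =
      taylorCoeff (fun i => v (ρ.1, i)) ρ.2.1 F := by
  have hsum : F = ∑ β : FormExp d δ, monomial β.1 (coeff β.1 F) := by
    conv_lhs => rw [F.as_sum]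
    rw [Finset.sum_coe_sort (Finset.finsuppAntidiag Finset.univ δ)
      fun β => (monomial β (coeff β F) : MvPolynomial (Fin (d + 1)) k)]
    refine Finset.sum_subset (fun β hβ => ?_) fun β _ hβ => ?_
    · rw [Finset.mem_finsuppAntidiag, ← Finsupp.degree_eq_sum]
      refine ⟨?_, Finset.subset_univ _⟩
      rw [Finsupp.degree_eq_weight_one]
      exact hF (mem_support_iff.1 hβ)
    · rw [notMem_support_iff.1 hβ, monomial_zero]
  conv_rhs => rw [hsum]
  rw [map_sum]
  refine Finset.sum_congr rfl fun β _ => ?_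
  rw [taylorCoeff_monomial, eval_conditionMatrix, mul_comm]

lemma fatForms_eq_bot_of_det_ne_zero {p : Fin r → ProjSpace k d}
    (ρ : FormExp d δ → Condition r d μ)
    (h : eval (fun x => (p x.1).rep x.2) ((conditionMatrix k d r δ μ).submatrix ρ id).det ≠ 0) :
    fatForms δ p (fun _ => μ) = ⊥ := by
  rw [eq_bot_iff]
  intro F hF
  obtain ⟨hFδ, hFp⟩ := Submodule.mem_inf.1 hF
  rw [mem_homogeneousSubmodule] at hFδ
  rw [RingHom.map_det] at h
  have hw : (fun β : FormExp d δ => coeff β.1 F) = 0 := by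
    refine Matrix.eq_zero_of_mulVec_eq_zero h (funext fun β => ?_)
    refine (sum_conditionMatrix_mul_coeff hFδ (fun x => (p x.1).rep x.2) (ρ β)).trans ?_
    exact taylorCoeff_eq_zero_of_mem_pow ((Submodule.mem_iInf _).1 hFp (ρ β).1) (ρ β).2.2
  rw [Submodule.mem_bot]
  ext β
  rw [coeff_zero]
  by_contra hne
  refine hne (congrFun hw ⟨β, ?_⟩)
  rw [Finset.mem_finsuppAntidiag, ← Finsupp.degree_eq_sum]
  refine ⟨?_, Finset.subset_univ _⟩
  rw [Finsupp.degree_eq_weight_one]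
  exact hFδ hne

/-- The open set is the locus where this minor does not vanish. Changing representatives of the
points rescales the rows by nonzero factors, so the locus contains the class of `v`. -/
lemma generalDimEq_zero_of_det_ne_zero (ρ : FormExp d δ → Condition r d μ)
    {v : Fin r → Fin (d + 1) → k} (hv : ∀ j, v j ≠ 0)
    (h : eval (fun x => v x.1 x.2) ((conditionMatrix k d r δ μ).submatrix ρ id).det ≠ 0) :
    GeneralDimEq k d δ (fun _ : Fin r => μ) 0 := by
  refine ⟨{p | eval (fun x => (p x.1).rep x.2)
    ((conditionMatrix k d r δ μ).submatrix ρ id).det ≠ 0},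
    ⟨{((conditionMatrix k d r δ μ).submatrix ρ id).det}, ?_, ?_⟩, ?_, ?_⟩
  · rintro _ rfl
    exact isMultihomogeneous_det ρ
  · simp
  · choose u hu using fun j => Projectivization.exists_smul_eq_mk_rep k (v j) (hv j)
    refine ⟨fun j => Projectivization.mk k (v j) (hv j), ?_⟩
    have hrep : (fun x : Fin r × Fin (d + 1) => (Projectivization.mk k (v x.1) (hv x.1)).rep x.2) =
        fun x => (fun j => (u j : k)) x.1 * v x.1 x.2 := by
      ext x
      rw [← hu]
      rfl
    rw [Set.mem_ofPred_eq, hrep, eval_det_smul ρ (fun j => (u j : k)) (fun x => v x.1 x.2)]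
    exact mul_ne_zero (Finset.prod_ne_zero_iff.2 fun β _ => pow_ne_zero _ (u _).ne_zero) h
  · intro p hp
    rw [fatForms_eq_bot_of_det_ne_zero ρ hp, rank_bot, Nat.cast_zero]

end ConditionMatrix

/-! ### The moving grid over `k[X]` and the conclusion -/

section GridCurve

open scoped Matrix
open Polynomial

variable {k : Type*} [Field k] {d s δ μ : ℕ}

/-- The lines, parametrized by the variable of `k[X]`, along which the points of the grid move in
the directions `gridDir`. -/
noncomputable def gridCurve (k : Type*) [Field k] (d s : ℕ) (j : Fin (s ^ d)) :
    Fin (d + 1) → k[X] :=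
  Fin.cons 1 fun i => C ((finFunctionFinEquiv.symm j i : ℕ) : k) +
    X * C (gridDir k (finFunctionFinEquiv.symm j) i)

/-- The matrix of the conditions at the moving points of the grid. -/
noncomputable def gridMatrix (k : Type*) [Field k] (d s δ μ : ℕ) :
    Matrix (Condition (s ^ d) d μ) (FormExp d δ) k[X] :=
  (conditionMatrix k d (s ^ d) δ μ).map (MvPolynomial.aeval fun x => gridCurve k d s x.1 x.2)

lemma eval_zero_choose_mul_pow (c a : k) (n m : ℕ) :
    (C ((n.choose m : ℕ) : k) * (C c + X * C a) ^ (n - m)).eval 0 =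
      ((n.choose m : ℕ) : k) * c ^ (n - m) := by
  simp

lemma eval_zero_derivative_choose_mul_pow (c a : k) (n m : ℕ) :
    (derivative (C ((n.choose m : ℕ) : k) * (C c + X * C a) ^ (n - m))).eval 0 =
      a * (m + 1 : ℕ) * (((n.choose (m + 1) : ℕ) : k) * c ^ (n - (m + 1))) := by
  have h : ((n.choose (m + 1) : ℕ) : k) * (m + 1 : ℕ) = (n.choose m : ℕ) * (n - m : ℕ) := by
    exact_mod_cast congrArg (Nat.cast (R := k)) (Nat.choose_succ_right_eq n m)
  rw [derivative_C_mul, derivative_pow]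
  simp only [derivative_add, derivative_mul, derivative_C, derivative_X, eval_mul, eval_add,
    eval_pow, eval_C, eval_X, eval_one, eval_zero, ← Nat.sub_sub]
  linear_combination (-(a * c ^ (n - m - 1))) * h

/-- Differentiating the Taylor coefficient of exponent `m` along the line `c + t a` gives the Taylor
coefficients of exponents `m + e_j` with weights `a j * (m j + 1)`; this is the source of the sum in
`eq_zero_of_vanish_first_order`. -/
lemma eval_zero_derivative_prod (c a : Fin d → k) (n m : Fin d →₀ ℕ) :
    (derivative (∏ i, C (((n i).choose (m i) : ℕ) : k) *
      (C (c i) + X * C (a i)) ^ (n i - m i))).eval 0 =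
      ∑ j, a j * (m j + 1 : ℕ) * taylorCoeff c (m + Finsupp.single j 1)
        (MvPolynomial.monomial n 1) := by
  rw [derivative_prod_finset, eval_finsetSum]
  refine Finset.sum_congr rfl fun j _ => ?_
  rw [eval_mul, eval_zero_derivative_choose_mul_pow, eval_prod, taylorCoeff_monomial, one_mul,
    ← Finset.mul_prod_erase _ _ (Finset.mem_univ j)]
  have h : ∏ i ∈ Finset.univ.erase j,
      ((((n i).choose ((m + Finsupp.single j 1 : Fin d →₀ ℕ) i) : ℕ) : k) *
        c i ^ (n i - (m + Finsupp.single j 1 : Fin d →₀ ℕ) i)) =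
      ∏ i ∈ Finset.univ.erase j, (C (((n i).choose (m i) : ℕ) : k) *
        (C (c i) + X * C (a i)) ^ (n i - m i)).eval 0 := by
    refine Finset.prod_congr rfl fun i hi => ?_
    rw [eval_zero_choose_mul_pow, Finsupp.add_apply,
      Finsupp.single_eq_of_ne (Finset.ne_of_mem_erase hi), add_zero]
  rw [h, Finsupp.add_apply, Finsupp.single_eq_same]
  ring

/-- The curve lies in the chart where coordinate `0` equals `1`, so derivatives not involving that
coordinate yield the affine Taylor conditions. -/
lemma aeval_conditionMatrix_cons (ρ : Fin (s ^ d)) (b : Fin d →₀ ℕ)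
    (hb : (Finsupp.cons 0 b).degree < μ) (β : FormExp d δ) :
    MvPolynomial.aeval (fun x => gridCurve k d s x.1 x.2)
      (conditionMatrix k d (s ^ d) δ μ (ρ, ⟨Finsupp.cons 0 b, hb⟩) β) =
      ∏ i, C (((β.1.tail i).choose (b i) : ℕ) : k) *
        (C ((finFunctionFinEquiv.symm ρ i : ℕ) : k) +
          X * C (gridDir k (finFunctionFinEquiv.symm ρ) i)) ^ (β.1.tail i - b i) := by
  rw [conditionMatrix, map_prod, Fin.prod_univ_succ]
  simp [gridCurve, Finsupp.tail_apply]

lemma apply_zero_add_degree_tail (β : FormExp d δ) : β.1 0 + β.1.tail.degree = δ := by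
  refine Eq.trans ?_ (degree_formExp β)
  rw [Finsupp.degree_eq_sum, Finsupp.degree_eq_sum, Fin.sum_univ_succ]
  rfl

lemma eq_of_tail_eq {β γ : FormExp d δ} (h : β.1.tail = γ.1.tail) : β = γ := by
  have h0 : β.1 0 = γ.1 0 := by
    have h1 := apply_zero_add_degree_tail β
    have h2 := apply_zero_add_degree_tail γ
    rw [h] at h1
    omega
  exact Subtype.ext (by rw [← Finsupp.cons_tail β.1, ← Finsupp.cons_tail γ.1, h, h0])

/-- The polynomial in affine coordinates with the given coefficients. -/
noncomputable def affinePoly (w : FormExp d δ → k) : MvPolynomial (Fin d) k :=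
  ∑ β, MvPolynomial.monomial β.1.tail (w β)

lemma coeff_affinePoly (w : FormExp d δ → k) (β : FormExp d δ) :
    MvPolynomial.coeff β.1.tail (affinePoly w) = w β := by
  classical
  rw [affinePoly, MvPolynomial.coeff_sum, Finset.sum_eq_single β]
  · simp
  · intro γ _ hγ
    rw [MvPolynomial.coeff_monomial, if_neg fun h => hγ (eq_of_tail_eq h)]
  · simp

lemma totalDegree_affinePoly_le (w : FormExp d δ → k) : (affinePoly w).totalDegree ≤ δ := by
  refine MvPolynomial.totalDegree_finsetSum_le fun β _ => ?_
  refine (MvPolynomial.totalDegree_monomial_le _ _).trans ?_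
  exact (Nat.le_add_left _ _).trans (apply_zero_add_degree_tail β).le

lemma taylorCoeff_affinePoly (c : Fin d → k) (b : Fin d →₀ ℕ) (w : FormExp d δ → k) :
    taylorCoeff c b (affinePoly w) =
      ∑ β : FormExp d δ, w β * taylorCoeff c b (MvPolynomial.monomial β.1.tail 1) := by
  rw [affinePoly, map_sum]
  refine Finset.sum_congr rfl fun β _ => ?_
  rw [taylorCoeff_monomial, taylorCoeff_monomial, one_mul]

variable [CharZero k]

/-- Write `w ≡ w(0) + X w'(0)` modulo `X ^ 2`. The kernel equation and its derivative at `0` are the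
two vanishing hypotheses of `eq_zero_of_vanish_first_order`, with `f` and `g` built from `w(0)` and
`w'(0)`, so `w(0) = 0`. -/
lemma X_dvd_of_mulVec_eq_zero (hs : 2 ≤ s) (hds : s + 2 ≤ d * (s - 1)) (hμ : 1 ≤ μ)
    (hδ : δ ≤ s * μ) {w : FormExp d δ → k[X]}
    (hw : gridMatrix k d s δ μ *ᵥ w = 0) (β : FormExp d δ) :
    X ∣ w β := by
  have hrow : ∀ (c : Fin d → Fin s) (b : Fin d →₀ ℕ), b.degree < μ →
      ∑ β : FormExp d δ, (∏ i, C (((β.1.tail i).choose (b i) : ℕ) : k) *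
        (C ((c i : ℕ) : k) + X * C (gridDir k c i)) ^ (β.1.tail i - b i)) * w β = 0 := by
    intro c b hb
    have hb' : (Finsupp.cons 0 b).degree < μ := by
      rwa [Finsupp.degree_eq_sum, Fin.sum_univ_succ, Finsupp.cons_zero, zero_add,
        Finset.sum_congr rfl fun i _ => Finsupp.cons_succ i 0 b, ← Finsupp.degree_eq_sum]
    have h := congrFun hw (finFunctionFinEquiv c, ⟨Finsupp.cons 0 b, hb'⟩)
    simp only [gridMatrix, Matrix.mulVec, dotProduct, Matrix.map_apply, aeval_conditionMatrix_cons,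
      Equiv.symm_apply_apply] at h
    exact h
  have hf : affinePoly (fun β => (w β).eval 0) = 0 := by
    refine eq_zero_of_vanish_first_order hs hds hμ
      (g := affinePoly fun β => (derivative (w β)).eval 0)
      ((totalDegree_affinePoly_le _).trans hδ) ((totalDegree_affinePoly_le _).trans hδ)
      (fun c b hb => ?_) fun c b hb => ?_
    · have h := congrArg (eval 0) (hrow c b hb)
      rw [eval_finsetSum, eval_zero] at h
      refine Eq.trans ?_ h
      rw [taylorCoeff_affinePoly]
      refine Finset.sum_congr rfl fun β _ => ?_
      rw [eval_mul, eval_prod, taylorCoeff_monomial, one_mul, mul_comm]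
      simp_rw [eval_zero_choose_mul_pow]
    · have h := congrArg (fun p => (derivative p).eval 0) (hrow c b hb)
      simp only [derivative_sum, eval_finsetSum, derivative_zero, eval_zero] at h
      refine Eq.trans ?_ h
      simp_rw [taylorCoeff_affinePoly, Finset.mul_sum]
      rw [Finset.sum_comm, ← Finset.sum_add_distrib]
      refine Finset.sum_congr rfl fun β _ => ?_
      rw [derivative_mul, eval_add, eval_mul, eval_mul, eval_prod, eval_zero_derivative_prod,
        Finset.sum_mul, add_comm]
      congr 1
      · exact Finset.sum_congr rfl fun j _ => by ring
      · rw [taylorCoeff_monomial, one_mul, mul_comm]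
        simp_rw [eval_zero_choose_mul_pow]
  rw [X_dvd_iff, coeff_zero_eq_eval_zero, ← coeff_affinePoly (fun β => (w β).eval 0) β, hf,
    MvPolynomial.coeff_zero]

lemma eq_zero_of_mulVec_eq_zero (hs : 2 ≤ s) (hds : s + 2 ≤ d * (s - 1)) (hμ : 1 ≤ μ)
    (hδ : δ ≤ s * μ) {w : FormExp d δ → k[X]}
    (hw : gridMatrix k d s δ μ *ᵥ w = 0) : w = 0 := by
  have hX : ∀ (n : ℕ) (w : FormExp d δ → k[X]), gridMatrix k d s δ μ *ᵥ w = 0 →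
      ∀ β, X ^ n ∣ w β := by
    intro n
    induction n with
    | zero => simp
    | succ n ih =>
      intro w hw β
      choose v hv using X_dvd_of_mulVec_eq_zero hs hds hμ hδ hw
      obtain rfl : w = (X : k[X]) • v := funext hv
      rw [Matrix.mulVec_smul] at hw
      rw [pow_succ', Pi.smul_apply, smul_eq_mul]
      exact mul_dvd_mul_left X (ih v ((smul_eq_zero.1 hw).resolve_left X_ne_zero) β)
  ext β n
  exact (X_pow_dvd_iff.1 (hX (n + 1) w hw β)) n (Nat.lt_succ_self n)

lemma exists_eval_ne_zero {p : k[X]} (hp : p ≠ 0) : ∃ t, p.eval t ≠ 0 := by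
  by_contra! h
  exact hp (Polynomial.funext fun t => by rw [h t, eval_zero])

theorem generalDimEq_zero (hs : 2 ≤ s) (hds : s + 2 ≤ d * (s - 1)) (hμ : 1 ≤ μ)
    (hδ : δ ≤ s * μ) : GeneralDimEq k d δ (fun _ : Fin (s ^ d) => μ) 0 := by
  obtain ⟨ρ, hρ⟩ := exists_det_submatrix_ne_zero (gridMatrix k d s δ μ)
    fun w hw => eq_zero_of_mulVec_eq_zero hs hds hμ hδ hw
  obtain ⟨t, ht⟩ := exists_eval_ne_zero hρ
  refine generalDimEq_zero_of_det_ne_zero ρ (v := fun j i => (gridCurve k d s j i).eval t)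
    (fun j hj => ?_) ?_
  · have := congrFun hj 0
    simp [gridCurve] at this
  · convert ht using 1
    have hcomp : ∀ g, MvPolynomial.eval (fun x => (gridCurve k d s x.1 x.2).eval t) g =
        (MvPolynomial.aeval (fun x : Fin (s ^ d) × Fin (d + 1) =>
          gridCurve k d s x.1 x.2) g).eval t := by
      intro g
      have : MvPolynomial.eval (fun x => (gridCurve k d s x.1 x.2).eval t) =
          (evalRingHom t).comp (MvPolynomial.aeval (R := k)
            (fun x : Fin (s ^ d) × Fin (d + 1) => gridCurve k d s x.1 x.2) :
              MvPolynomial (Fin (s ^ d) × Fin (d + 1)) k →+* k[X]) := by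
        ext <;> simp
      rw [this]
      rfl
    rw [hcomp, ← AlgHom.coe_toRingHom, RingHom.map_det]
    rfl

end GridCurve

end FatPoints

theorem theorem1 (k : Type*) [Field k] [IsAlgClosed k] [CharZero k]
    (d r s δ μ : ℕ) (hd : 2 ≤ d) (hs : 2 ≤ s) (hr : r = s ^ d)
    (hrd : (r, d) ∉ ({(4, 2), (9, 2), (8, 3)} : Set (ℕ × ℕ)))
    (hμ : 1 ≤ μ) (hδ : δ ≤ s * μ) :
    FatPoints.GeneralDimEq k d δ (fun _ : Fin r => μ) 0 := by
  subst hr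
  refine FatPoints.generalDimEq_zero hs ?_ hμ hδ
  -- The inequality `s + 2 ≤ d(s-1)` means `s ≥ 4` for `d = 2`, `s ≥ 3` for `d = 3`, and always
  -- holds for `d ≥ 4`; it fails exactly in the three excluded cases.
  obtain ⟨t, rfl⟩ : ∃ t, s = t + 2 := ⟨s - 2, by omega⟩
  rw [show t + 2 - 1 = t + 1 from rfl]
  obtain rfl | rfl | h : d = 2 ∨ d = 3 ∨ 4 ≤ d := by omega
  · have h0 : t ≠ 0 := by rintro rfl; simp at hrd
    have h1 : t ≠ 1 := by rintro rfl; simp at hrd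
    omega
  · have h0 : t ≠ 0 := by rintro rfl; simp at hrd
    omega
  · nlinarith
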